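/- A finitely generated residually finite group $\Gamma$ is called \emph{L\"ucky} if for every descending chain $N_1 \supseteq N_2 \supseteq \dots$ of finite-index normal subgroups of $\Gamma$ with $\bigcap_{j} N_j = \{1\}$ one has \[ \lim_{j\to\infty} \frac{b_1(N_j,\mathbb{Q})}{|\Gamma : N_j|} = b_1^{(2)}(\Gamma), \] where $b_1(N,\mathbb{Q}) = \dim_{\mathbb{Q}} H^1(N,\mathbb{Q})$ and where $b_1^{(2)}(\Gamma) = \dim_{\mathcal{N}(\Gamma)} H_1(\Gamma; \mathcal{N}(\Gamma))$ is the first $\ell^2$-Betti number of $\Gamma$, i.e. the von Neumann dimension of the first homology of $\Gamma$ with coefficients in its group von Neumann algebra $\mathcal{N}(\Gamma)$. \textbf{Theorem.} The first $\ell^2$-Betti number is a profinite invariant among L\"ucky groups: if $\Gamma$ and $\Delta$ are L\"ucky groups whose profinite completions are isomorphic as profinite groups (that is, $\widehat{\Gamma} \cong \widehat{\Delta}$ as topological groups), then $b_1^{(2)}(\Gamma) = b_1^{(2)}(\Delta)$. -/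

import Mathlib

open Filter Topology
open scoped ENNReal lp

noncomputable section

namespace L2Betti

universe u

/-! ### The group von Neumann algebra -/

section VonNeumann

variable (G : Type u)

/-- The Hilbert space `ℓ²(G)` of square-summable functions `G → ℂ`. -/
abbrev EllTwo : Type u := lp (fun _ : G => ℂ) 2

variable {G}

theorem memlp_comp (e : G ≃ G) (f : EllTwo G) : Memℓp (fun x => f (e x)) 2 := by
  have h2 : 0 < (2 : ℝ≥0∞).toReal := by norm_num
  exact memℓp_gen (e.summable_iff.mpr ((lp.memℓp f).summable h2))

/-- The isometric operator `f ↦ f ∘ e` on `ℓ²(G)` induced by a permutation `e` of `G`. -/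
def permOp (e : G ≃ G) : EllTwo G →L[ℂ] EllTwo G :=
  LinearIsometry.toContinuousLinearMap
    { toFun := fun f => ⟨fun x => f (e x), memlp_comp e f⟩
      map_add' := fun _ _ => rfl
      map_smul' := fun _ _ => rfl
      norm_map' := fun f => by
        have h2 : 0 < (2 : ℝ≥0∞).toReal := by norm_num
        rw [lp.norm_eq_tsum_rpow h2, lp.norm_eq_tsum_rpow h2]
        congr 1
        exact e.tsum_eq (fun x => ‖f x‖ ^ (2 : ℝ≥0∞).toReal) }

@[simp] theorem permOp_apply (e : G ≃ G) (f : EllTwo G) (x : G) :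
    permOp e f x = f (e x) := rfl

variable [Group G]

/-- Left translation on `ℓ²(G)`: `(λ_g f)(x) = f (g⁻¹ x)`, so `λ_g δ_h = δ_{gh}`. -/
def leftTranslation (g : G) : EllTwo G →L[ℂ] EllTwo G := permOp (Equiv.mulLeft g⁻¹)

/-- Right translation on `ℓ²(G)`: `(ρ_g f)(x) = f (x g)`, so `ρ_g δ_h = δ_{h g⁻¹}`. -/
def rightTranslation (g : G) : EllTwo G →L[ℂ] EllTwo G := permOp (Equiv.mulRight g)

variable (G)

/-- The group von Neumann algebra `𝒩(G) = B(ℓ²(G))^G`: the algebra of all bounded operators on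
`ℓ²(G)` which commute with the left translations by elements of `G`. -/
def groupVNSubalgebra : Subalgebra ℂ (EllTwo G →L[ℂ] EllTwo G) :=
  Subalgebra.centralizer ℂ (Set.range (leftTranslation (G := G)))

/-- The group von Neumann algebra `𝒩(G)` as a type, with its ring structure (the product is the
composition of operators). -/
def GroupVN : Type u := groupVNSubalgebra G

instance : Ring (GroupVN G) := inferInstanceAs (Ring (groupVNSubalgebra G))

variable {G}

/-- The bounded operator on `ℓ²(G)` given by an element of `𝒩(G)`. -/
def GroupVN.toOp : GroupVN G →+* (EllTwo G →L[ℂ] EllTwo G) :=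
  (groupVNSubalgebra G).subtype

/-- The canonical homomorphism `g ↦ ρ_g` from `G` to the multiplicative monoid of `𝒩(G)`. -/
def ofGroup : G →* GroupVN G where
  toFun g := ⟨rightTranslation g, by
    rw [groupVNSubalgebra, Subalgebra.mem_centralizer_iff]
    rintro _ ⟨h, rfl⟩
    ext f x
    simp [leftTranslation, rightTranslation, mul_assoc]⟩
  map_one' := by
    apply Subtype.ext
    exact ContinuousLinearMap.ext fun f => lp.ext (funext fun x => congrArg f (mul_one x))
  map_mul' g h := by
    apply Subtype.ext
    exact ContinuousLinearMap.ext fun f =>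
      lp.ext (funext fun x => congrArg f (mul_assoc x g h).symm)

open Classical in
/-- The von Neumann trace `tr(a) = ⟨δ_1, a δ_1⟩` on `𝒩(G)`. -/
def vnTrace (a : GroupVN G) : ℂ :=
  inner ℂ (lp.single 2 (1 : G) (1 : ℂ) : EllTwo G)
    (a.toOp (lp.single 2 (1 : G) (1 : ℂ)))

/-- The trace of a square matrix over `𝒩(G)`: the sum of the von Neumann traces of the diagonal
entries. -/
def vnMatrixTrace {n : ℕ} (A : Matrix (Fin n) (Fin n) (GroupVN G)) : ℂ :=
  ∑ i, vnTrace (A i i)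

/-- The left `𝒩(G)`-submodule `𝒩(G)ⁿ A` of `𝒩(G)ⁿ` (row vectors): the image of right multiplication
by the matrix `A`. Up to isomorphism, the finitely generated projective left `𝒩(G)`-modules are
exactly those with `A` idempotent. -/
def rowSpan {n : ℕ} (A : Matrix (Fin n) (Fin n) (GroupVN G)) :
    Submodule (GroupVN G) (Fin n → GroupVN G) :=
  LinearMap.range A.vecMulLinear

/-- Lück's extended von Neumann dimension of an arbitrary left `𝒩(G)`-module `M`: the supremum in
`[0, ∞]` of the dimensions of the finitely generated projective submodules `P` of `M`, where
`dim P = tr A` for any idempotent matrix `A` over `𝒩(G)` such that `P` is isomorphic to `𝒩(G)ⁿ A`.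
(The trace of an idempotent matrix is a nonnegative real number.) -/
def vnDim (M : Type u) [AddCommGroup M] [Module (GroupVN G) M] : ℝ≥0∞ :=
  ⨆ (P : Submodule (GroupVN G) M) (n : ℕ) (A : Matrix (Fin n) (Fin n) (GroupVN G))
    (_ : IsIdempotentElem A) (_ : Nonempty (P ≃ₗ[GroupVN G] rowSpan A)),
    ENNReal.ofReal (vnMatrixTrace A).re

end VonNeumann

/-! ### The first `ℓ²`-Betti number

`𝒩(G) ⊗_{ℤG} (bar resolution of G)` in degrees `2 → 1 → 0`. The element `a ⊗ [g₁ | … | gₙ]` is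
written as the finitely supported function with value `a` at `(g₁, …, gₙ)`. -/

section Betti

variable (G : Type u) [Group G]

/-- The differential `a ⊗ [g] ↦ a ρ_g - a`. -/
def barD₁ : (G →₀ GroupVN G) →ₗ[GroupVN G] GroupVN G :=
  Finsupp.linearCombination (GroupVN G) fun g => ofGroup g - 1

/-- The differential `a ⊗ [g | h] ↦ a ρ_g ⊗ [h] - a ⊗ [gh] + a ⊗ [g]`. -/
def barD₂ : (G × G →₀ GroupVN G) →ₗ[GroupVN G] (G →₀ GroupVN G) :=
  Finsupp.linearCombination (GroupVN G) fun p =>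
    Finsupp.single p.2 (ofGroup p.1) - Finsupp.single (p.1 * p.2) 1 + Finsupp.single p.1 1

theorem barD₁_comp_barD₂ : barD₁ G ∘ₗ barD₂ G = 0 := by
  apply Finsupp.lhom_ext'
  intro p
  apply LinearMap.ext_ring
  simp only [barD₁, barD₂, LinearMap.comp_apply, Finsupp.lsingle_apply,
    Finsupp.linearCombination_single, one_smul, map_add, map_sub, smul_eq_mul, map_mul,
    LinearMap.zero_apply]
  noncomm_ring

/-- The cycles in degree `1`. -/
def cycles₁VN : Submodule (GroupVN G) (G →₀ GroupVN G) := LinearMap.ker (barD₁ G)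

instance : AddCommGroup (cycles₁VN G) := Submodule.addCommGroup (cycles₁VN G)

/-- The boundaries in degree `1`, as a submodule of the cycles. -/
def boundaries₁VN : Submodule (GroupVN G) (cycles₁VN G) :=
  (LinearMap.range (barD₂ G)).submoduleOf (cycles₁VN G)

/-- The group homology `H₁(G; 𝒩(G))`, as a left `𝒩(G)`-module: cycles modulo boundaries. -/
abbrev H₁VN : Type u := cycles₁VN G ⧸ boundaries₁VN G

/-- The first `ℓ²`-Betti number `b₁⁽²⁾(G) = dim_{𝒩(G)} H₁(G; 𝒩(G)) ∈ [0, ∞]`. -/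
def firstL2Betti : ℝ≥0∞ := vnDim (G := G) (H₁VN G)

/-- The first rational Betti number `b₁(G, ℚ) = dim_ℚ H¹(G, ℚ)`. (Mathlib's group cohomology wants
the coefficients in the universe of `G`, whence the `ULift`.) -/
def firstBetti : ℕ :=
  Module.finrank (ULift.{u} ℚ)
    (groupCohomology.H1 (Rep.trivial (ULift.{u} ℚ) G (ULift.{u} ℚ)))

/-- A Lücky group: a finitely generated residually finite group which satisfies Lück approximation
in degree `1` along every descending chain of finite-index normal subgroups with trivial
intersection. -/
structure IsLucky : Prop where
  fg : Group.FG G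
  residuallyFinite : Group.ResiduallyFinite G
  approximation : ∀ N : ℕ → Subgroup G, Antitone N → (∀ j, (N j).Normal) →
    (∀ j, (N j).FiniteIndex) → ⨅ j, N j = ⊥ →
    Tendsto (fun j => (firstBetti (N j) : ℝ≥0∞) / ((N j).index : ℝ≥0∞)) atTop
      (𝓝 (firstL2Betti G))

/-- The profinite completion of `G`: the inverse limit of its finite quotients, a profinite
group. -/
abbrev Completion : ProfiniteGrp.{u} := ProfiniteGrp.ProfiniteCompletion.completion (GrpCat.of G)

end Betti

end L2Betti

end

/-!
The first `ℓ²`-Betti number enters only as the limit in Lück approximation, so it suffices to find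
chains in the two groups along which the quotients `b₁ / index` agree term by term.

Let `K` be the common profinite completion, with `ι : Γ → K` and `κ : Δ → K` the canonical maps. For
an open normal subgroup `W` of `K`, the subgroups `ι⁻¹(W)` and `κ⁻¹(W)` both have index `[K : W]`
(`IsProfiniteDense.index_comap`), and `W` is the profinite completion of each
(`IsProfiniteDense.subgroupComap`). Hence both have as many homomorphisms to `ℤ/p` as `W` has
continuous ones (`IsProfiniteDense.restrict_bijective`). For a finitely generated group and all but
finitely many primes `p` this number is `p ^ b₁` (`exists_card_hom_zmod_eq`), because the
abelianization is `ℤʳ × T` with `T` finite; so the first Betti numbers agree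
(`firstBetti_eq_of_isProfiniteDense`).

As `Γ` and `Δ` are countable and residually finite, each is separated by a sequence of open normal
subgroups of `K` (`IsProfiniteDense.exists_seq_iInf_eq_bot`). A descending sequence that refines
both pulls back to admissible chains in `Γ` and in `Δ`, and the two limits coincide.
-/

namespace L2Betti

universe u v

/-! ### The first Betti number counts homomorphisms to finite fields -/

/-- A finitely generated abelian group is `ℤʳ × T` with `T` finite. Homomorphisms from `T` to a
field in which `|T|` is invertible vanish, so over such a field the homomorphisms from a finitely
generated group form a space of dimension `r`. -/
theorem exists_addMonoidHom_linearEquiv (G : Type u) [Group G] [Group.FG G] :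
    ∃ r n : ℕ, n ≠ 0 ∧ ∀ (k : Type u) [Field k], (n : k) ≠ 0 →
      Nonempty ((Additive G →+ k) ≃ₗ[k] (Fin r → k)) := by
  have : Group.FG (Abelianization G) := QuotientGroup.fg (commutator G)
  obtain ⟨r, ι, _, p, hp, m, ⟨e⟩⟩ :=
    AddCommGroup.equiv_free_prod_directSum_zmod (Additive (Abelianization G))
  let T := DirectSum ι fun i => ZMod (p i ^ m i)
  let n := ∏ i, p i ^ m i
  have hT : ∀ t : T, n • t = 0 := by
    intro t
    refine DFinsupp.ext fun i => ?_
    rw [DFinsupp.smul_apply, DFinsupp.zero_apply, nsmul_eq_mul]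
    have : (n : ZMod (p i ^ m i)) = 0 :=
      (ZMod.natCast_eq_zero_iff _ _).mpr (Finset.dvd_prod_of_mem _ (Finset.mem_univ i))
    rw [this, zero_mul]
  refine ⟨r, n, Finset.prod_ne_zero_iff.mpr fun i _ => pow_ne_zero _ (hp i).ne_zero, ?_⟩
  intro k _ hn
  let q : Additive G →+ (Fin r →₀ ℤ) × T :=
    e.toAddMonoidHom.comp (MonoidHom.toAdditive (Abelianization.of (G := G)))
  have hq : Function.Surjective q := by
    refine e.surjective.comp ?_
    exact fun x => QuotientGroup.mk_surjective (s := commutator G) x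
  choose b hb using fun i : Fin r => hq (Finsupp.single i 1, 0)
  let ev : (Additive G →+ k) →ₗ[k] (Fin r → k) :=
    { toFun := fun f i => f (b i)
      map_add' := fun _ _ => rfl
      map_smul' := fun _ _ => rfl }
  refine ⟨LinearEquiv.ofBijective ev ⟨?_, ?_⟩⟩
  · rw [injective_iff_map_eq_zero]
    intro f hf
    -- `f` descends to the abelianization because its target is commutative
    let f' : (Fin r →₀ ℤ) × T →+ k :=
      (MonoidHom.toAdditiveLeft (Abelianization.lift (AddMonoidHom.toMultiplicativeRight f))).comp
        e.symm.toAddMonoidHom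
    have hf' : ∀ x, f' (q x) = f x := by
      intro x
      simp only [f', q, AddMonoidHom.comp_apply]
      change (MonoidHom.toAdditiveLeft (Abelianization.lift
        (AddMonoidHom.toMultiplicativeRight f))) (e.symm (e _)) = _
      rw [e.symm_apply_apply]
      rfl
    have h1 : f'.comp (AddMonoidHom.inl _ _) = 0 := by
      refine Finsupp.addHom_ext' fun i => ?_
      ext
      have := congrFun hf i
      change f (b i) = 0 at this
      rw [← hf', hb] at this
      simpa using this
    have h2 : ∀ t, f' (0, t) = 0 := by
      intro t
      have : n • f' (0, t) = 0 := by
        rw [← map_nsmul, Prod.smul_mk, hT, smul_zero]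
        exact map_zero f'
      rw [nsmul_eq_mul] at this
      exact (mul_eq_zero.mp this).resolve_left hn
    refine AddMonoidHom.ext fun x => ?_
    have h3 := DFunLike.congr_fun h1 (q x).1
    have h4 : q x = ((q x).1, 0) + (0, (q x).2) := by simp
    rw [← hf', h4, map_add, h2]
    simpa using h3
  · intro c
    refine ⟨((Finsupp.liftAddHom fun i => (AddMonoidHom.mulRight (c i)).comp
      (Int.castAddHom k)).comp (AddMonoidHom.fst _ T)).comp q, ?_⟩
    funext i
    change (Finsupp.liftAddHom fun i => (AddMonoidHom.mulRight (c i)).comp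
      (Int.castAddHom k)) (q (b i)).1 = c i
    rw [hb]
    simp

/-- For all primes outside a finite set, the first Betti number of a finitely generated group is
read off from the number of homomorphisms to `ℤ/p`. -/
theorem exists_card_hom_zmod_eq (G : Type u) [Group G] [Group.FG G] :
    ∃ n : ℕ, n ≠ 0 ∧ ∀ p : ℕ, p.Prime → ¬ p ∣ n →
      Nat.card (G →* Multiplicative (ZMod p)) = p ^ firstBetti G := by
  obtain ⟨r, n, hn, H⟩ := exists_addMonoidHom_linearEquiv G
  have hb : firstBetti G = r := by
    obtain ⟨e⟩ := H (ULift.{u} ℚ) (fun h => hn (by simpa using congrArg ULift.down h))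
    have e₁ := (groupCohomology.H1IsoOfIsTrivial
      (Rep.trivial (ULift.{u} ℚ) G (ULift.{u} ℚ))).toLinearEquiv
    rw [firstBetti, e₁.finrank_eq]
    exact e.finrank_eq.trans (Module.finrank_fin_fun _)
  refine ⟨n, hn, fun p hp hpn => ?_⟩
  have : Fact p.Prime := ⟨hp⟩
  obtain ⟨e⟩ := H (ULift.{u} (ZMod p)) (fun h => hpn (by
    rw [← ZMod.natCast_eq_zero_iff]; simpa using congrArg ULift.down h))
  let e₁ : (G →* Multiplicative (ZMod p)) ≃ (Additive G →+ ULift.{u} (ZMod p)) :=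
    MonoidHom.toAdditiveLeft.trans
      (AddEquiv.ulift (α := ZMod p)).symm.addMonoidHomCongrRightEquiv
  rw [Nat.card_congr (e₁.trans e.toEquiv), hb]
  simp

/-! ### Dense maps inducing the profinite topology -/

/-- A homomorphism `ι` to a topological group with dense image such that the preimages of the open
normal subgroups are cofinal among the finite-index subgroups. When the target is profinite, this
says that `ι` is a profinite completion. -/
structure IsProfiniteDense {G : Type u} {K : Type v} [Group G] [Group K] [TopologicalSpace K]
    (ι : G →* K) : Prop where
  dense : DenseRange ι
  exists_comap_le : ∀ L : Subgroup G, L.FiniteIndex →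
    ∃ U : OpenNormalSubgroup K, (U : Subgroup K).comap ι ≤ L

variable {G : Type u} {K : Type v} [Group G] [Group K] [TopologicalSpace K]

namespace IsProfiniteDense

/-- An open normal subgroup over `L` is the kernel of the projection of the inverse limit to the
finite quotient of `G` by the normal core of `L`. -/
theorem completion (G : Type u) [Group G] :
    IsProfiniteDense (ProfiniteGrp.ProfiniteCompletion.eta (GrpCat.of G)).hom where
  dense := ProfiniteGrp.ProfiniteCompletion.denseRange (GrpCat.of G)
  exists_comap_le L _ := by
    let H : FiniteIndexNormalSubgroup (GrpCat.of G) := .ofSubgroup L.normalCore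
    let Q := (ProfiniteGrp.ProfiniteCompletion.diagram (GrpCat.of G)).obj H
    let f : Completion G →ₜ* Q := ((ProfiniteGrp.limitCone
      (ProfiniteGrp.ProfiniteCompletion.diagram (GrpCat.of G))).π.app H).hom
    have : DiscreteTopology Q := ⟨rfl⟩
    have hopen : IsOpen (f.toMonoidHom.ker : Set (Completion G)) :=
      (isOpen_discrete ({1} : Set Q)).preimage f.continuous_toFun
    refine ⟨{ toSubgroup := f.toMonoidHom.ker, isOpen' := hopen }, fun x hx => ?_⟩
    exact L.normalCore_le ((QuotientGroup.eq_one_iff (N := L.normalCore) x).mp hx)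

theorem comp_continuousMulEquiv {K' : Type*} [Group K'] [TopologicalSpace K'] {ι : G →* K}
    (h : IsProfiniteDense ι) (e : K ≃ₜ* K') :
    IsProfiniteDense ((e : K →* K').comp ι) where
  dense := e.surjective.denseRange.comp h.dense e.continuous
  exists_comap_le L hL := by
    obtain ⟨U, hU⟩ := h.exists_comap_le L hL
    refine ⟨{ toSubgroup := (U : Subgroup K).comap (e.symm : K' →* K),
              isOpen' := U.isOpen'.preimage e.symm.continuous,
              isNormal' := U.isNormal'.comap _ }, fun x hx => hU ?_⟩
    have hx' : e.symm (e (ι x)) ∈ (U : Subgroup K) := hx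
    rwa [e.symm_apply_apply] at hx'

variable {ι : G →* K} (h : IsProfiniteDense ι)
include h

theorem exists_mem_of_isOpen [IsTopologicalGroup K] {U : Subgroup K}
    (hU : IsOpen (U : Set K)) (x : K) :
    ∃ g, x⁻¹ * ι g ∈ U := by
  have ho : IsOpen ((fun y => x⁻¹ * y) ⁻¹' (U : Set K)) := hU.preimage (continuous_const_mul _)
  obtain ⟨g, hg⟩ := h.dense.exists_mem_open ho ⟨x, by simp⟩
  exact ⟨g, hg⟩

theorem quotientMap_bijective [IsTopologicalGroup K] (U : OpenNormalSubgroup K) :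
    Function.Bijective (QuotientGroup.map ((U : Subgroup K).comap ι) (U : Subgroup K) ι le_rfl) := by
  constructor
  · rw [injective_iff_map_eq_one]
    intro x hx
    induction x using QuotientGroup.induction_on with
    | H x => exact (QuotientGroup.eq_one_iff _).mpr ((QuotientGroup.eq_one_iff (ι x)).mp hx)
  · intro y
    induction y using QuotientGroup.induction_on with
    | H y =>
      obtain ⟨g, hg⟩ := h.exists_mem_of_isOpen U.isOpen' y
      exact ⟨(g : G ⧸ _), (QuotientGroup.eq.mpr hg).symm⟩

theorem index_comap [IsTopologicalGroup K] (U : OpenNormalSubgroup K) :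
    ((U : Subgroup K).comap ι).index = (U : Subgroup K).index :=
  Nat.card_congr (Equiv.ofBijective _ (h.quotientMap_bijective U))

/-- An open normal subgroup `W` of a profinite completion of `G` is the profinite completion of its
preimage in `G`. -/
theorem subgroupComap [IsTopologicalGroup K] [CompactSpace K] (W : OpenNormalSubgroup K) :
    IsProfiniteDense (ι.subgroupComap (W : Subgroup K)) where
  dense := by
    rw [DenseRange, dense_iff_inter_open]
    rintro _ ⟨V, hV, rfl⟩ ⟨x, hx⟩
    obtain ⟨g, hgV, hgW⟩ := h.dense.exists_mem_open (hV.inter W.isOpen') ⟨x, hx, x.2⟩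
    exact ⟨_, hgV, ⟨g, hgW⟩, rfl⟩
  exists_comap_le L _ := by
    have : ((W : Subgroup K).comap ι).FiniteIndex :=
      ⟨by rw [h.index_comap]; exact W.toFiniteIndexNormalSubgroup.isFiniteIndex'.index_ne_zero⟩
    have hL : (L.map ((W : Subgroup K).comap ι).subtype).FiniteIndex := by
      constructor
      rw [Subgroup.index_map_subtype]
      exact mul_ne_zero Subgroup.FiniteIndex.index_ne_zero Subgroup.FiniteIndex.index_ne_zero
    obtain ⟨U, hU⟩ := h.exists_comap_le _ hL
    refine ⟨{ toSubgroup := (U : Subgroup K).subgroupOf W,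
              isOpen' := U.isOpen'.preimage continuous_subtype_val,
              isNormal' := U.isNormal'.comap _ }, fun x hx => ?_⟩
    obtain ⟨y, hy, hyx⟩ := hU (show (x : G) ∈ (U : Subgroup K).comap ι from hx)
    rwa [← Subtype.ext hyx]

/-- Homomorphisms from `G` to a finite group extend uniquely to homomorphisms from `K` that are
continuous for the discrete topology, that is, have an open kernel. -/
theorem restrict_bijective [IsTopologicalGroup K] (A : Type*) [Group A] [Finite A] :
    Function.Bijective fun f : {f : K →* A // IsOpen (f.ker : Set K)} => f.1.comp ι := by
  constructor
  · rintro ⟨f₁, h₁⟩ ⟨f₂, h₂⟩ hf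
    refine Subtype.ext (MonoidHom.ext fun x => ?_)
    obtain ⟨g, hg₁, hg₂⟩ := h.exists_mem_of_isOpen (U := f₁.ker ⊓ f₂.ker) (h₁.inter h₂) x
    have e₁ : f₁ x = f₁ (ι g) := by simpa [MonoidHom.mem_ker, inv_mul_eq_one] using hg₁
    have e₂ : f₂ x = f₂ (ι g) := by simpa [MonoidHom.mem_ker, inv_mul_eq_one] using hg₂
    exact e₁.trans ((DFunLike.congr_fun hf g).trans e₂.symm)
  · intro f
    obtain ⟨U, hU⟩ := h.exists_comap_le f.ker (Subgroup.finiteIndex_ker f)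
    let e := MulEquiv.ofBijective _ (h.quotientMap_bijective U)
    -- `f` factors through `G ⧸ ι⁻¹(U)`, which is `K ⧸ U` by density
    let F : K →* A := ((QuotientGroup.lift _ f hU).comp e.symm.toMonoidHom).comp
      (QuotientGroup.mk' (U : Subgroup K))
    have hUF : (U : Subgroup K) ≤ F.ker := fun x hx => by
      have : (x : K ⧸ (U : Subgroup K)) = 1 := (QuotientGroup.eq_one_iff x).mpr hx
      simp [F, MonoidHom.mem_ker, this]
    refine ⟨⟨F, Subgroup.isOpen_mono hUF U.isOpen'⟩, MonoidHom.ext fun g => ?_⟩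
    change QuotientGroup.lift _ f hU (e.symm (e (g : G ⧸ _))) = f g
    rw [e.symm_apply_apply]
    rfl

end IsProfiniteDense

/-! ### Comparison of two groups with the same profinite completion -/

variable {H : Type*} [Group H] {ι : G →* K} {κ : H →* K}

/-- The homomorphisms to `ℤ/p` are those of the common completion with open kernel, and their number
determines the first Betti number once `p` avoids finitely many primes. -/
theorem firstBetti_eq_of_isProfiniteDense [Group.FG G] [Group.FG H] [IsTopologicalGroup K]
    (hι : IsProfiniteDense ι) (hκ : IsProfiniteDense κ) : firstBetti G = firstBetti H := by
  obtain ⟨n, hn, hG⟩ := exists_card_hom_zmod_eq G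
  obtain ⟨m, hm, hH⟩ := exists_card_hom_zmod_eq H
  -- a prime larger than `n` and `m` divides neither
  obtain ⟨p, hle, hp⟩ := Nat.exists_infinite_primes (n + m + 1)
  have : Fact p.Prime := ⟨hp⟩
  have hpn : ¬ p ∣ n := Nat.not_dvd_of_pos_of_lt (by omega) (by omega)
  have hpm : ¬ p ∣ m := Nat.not_dvd_of_pos_of_lt (by omega) (by omega)
  refine Nat.pow_right_injective hp.two_le ?_
  change p ^ firstBetti G = p ^ firstBetti H
  have : Finite (Multiplicative (ZMod p)) := inferInstanceAs (Finite (ZMod p))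
  rw [← hG p hp hpn, ← hH p hp hpm,
    ← Nat.card_congr (Equiv.ofBijective _ (hι.restrict_bijective (Multiplicative (ZMod p)))),
    Nat.card_congr (Equiv.ofBijective _ (hκ.restrict_bijective (Multiplicative (ZMod p))))]

/-- A countable residually finite group is separated by a sequence of open normal subgroups of its
profinite completion. -/
theorem IsProfiniteDense.exists_seq_iInf_eq_bot [Countable G] [Group.ResiduallyFinite G]
    (h : IsProfiniteDense ι) :
    ∃ U : ℕ → OpenNormalSubgroup K, ⨅ j, (U j : Subgroup K).comap ι = ⊥ := by
  have key : ∀ g : G, ∃ U : OpenNormalSubgroup K, g ≠ 1 → ι g ∉ U := by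
    intro g
    by_cases hg : g = 1
    -- nothing is required of `U` here; any open normal subgroup will do
    · obtain ⟨U, -⟩ := h.exists_comap_le ⊤ inferInstance
      exact ⟨U, fun h => (h hg).elim⟩
    · obtain ⟨L, hL⟩ := Group.exists_finiteIndexNormalSubgroup_notMem g hg
      obtain ⟨U, hU⟩ := h.exists_comap_le L.toSubgroup inferInstance
      exact ⟨U, fun _ hgU => hL (hU hgU)⟩
  choose U hU using key
  obtain ⟨s, hs⟩ := exists_surjective_nat G
  refine ⟨U ∘ s, (Subgroup.eq_bot_iff_forall _).mpr fun g hg => ?_⟩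
  by_contra hg1
  obtain ⟨j, rfl⟩ := hs g
  exact hU _ hg1 ((Subgroup.mem_iInf.mp hg) j)

theorem exists_antitone_le (U : ℕ → OpenNormalSubgroup K) :
    ∃ W : ℕ → OpenNormalSubgroup K, Antitone W ∧ ∀ j, W j ≤ U j := by
  let W : ℕ → OpenNormalSubgroup K := fun j => Nat.rec (U 0) (fun i V => V ⊓ U (i + 1)) j
  refine ⟨W, antitone_nat_of_succ_le fun j => inf_le_left, fun j => ?_⟩
  cases j with
  | zero => exact le_rfl
  | succ j => exact inf_le_right

theorem IsLucky.countable (hG : IsLucky G) : Countable G := by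
  obtain ⟨S, _, φ, hφ⟩ := Group.fg_iff_exists_freeGroup_hom_surjective_finite.mp hG.fg
  exact hφ.countable

/-- The quotients of Betti numbers by indices converge along the preimages of a sequence of open
normal subgroups. -/
theorem IsLucky.tendsto_comap [IsTopologicalGroup K] [CompactSpace K] (hG : IsLucky G)
    (hι : IsProfiniteDense ι) {W : ℕ → OpenNormalSubgroup K} (hW : Antitone W)
    (hbot : ⨅ j, (W j : Subgroup K).comap ι = ⊥) :
    Tendsto (fun j => (firstBetti ((W j : Subgroup K).comap ι) : ℝ≥0∞) /
      ((W j : Subgroup K).index : ℝ≥0∞)) atTop (𝓝 (firstL2Betti G)) := by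
  have := hG.approximation (fun j => (W j : Subgroup K).comap ι)
    (fun i j hij => Subgroup.comap_mono (hW hij)) (fun j => (W j).isNormal'.comap ι)
    (fun j => ((W j).toFiniteIndexNormalSubgroup.comap ι).isFiniteIndex') hbot
  simpa only [hι.index_comap] using this

/-- Refining a separating sequence for `G` by one for `H` gives a descending sequence of open normal
subgroups of `K` along which both groups satisfy Lück approximation, with equal terms. -/
theorem IsLucky.firstL2Betti_eq [IsTopologicalGroup K] [CompactSpace K] (hG : IsLucky G)
    (hH : IsLucky H) (hι : IsProfiniteDense ι) (hκ : IsProfiniteDense κ) :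
    firstL2Betti G = firstL2Betti H := by
  have := hG.fg
  have := hH.fg
  have := hG.countable
  have := hH.countable
  have := hG.residuallyFinite
  have := hH.residuallyFinite
  obtain ⟨U, hU⟩ := hι.exists_seq_iInf_eq_bot
  obtain ⟨V, hV⟩ := hκ.exists_seq_iInf_eq_bot
  obtain ⟨W, hW, hle⟩ := exists_antitone_le fun j => U j ⊓ V j
  have hWU : ⨅ j, (W j : Subgroup K).comap ι = ⊥ :=
    le_bot_iff.mp (hU ▸ iInf_mono fun j => Subgroup.comap_mono ((hle j).trans inf_le_left))
  have hWV : ⨅ j, (W j : Subgroup K).comap κ = ⊥ :=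
    le_bot_iff.mp (hV ▸ iInf_mono fun j => Subgroup.comap_mono ((hle j).trans inf_le_right))
  have hb : ∀ j, firstBetti ((W j : Subgroup K).comap ι) =
      firstBetti ((W j : Subgroup K).comap κ) := by
    intro j
    have : ((W j : Subgroup K).comap ι).FiniteIndex :=
      ((W j).toFiniteIndexNormalSubgroup.comap ι).isFiniteIndex'
    have : ((W j : Subgroup K).comap κ).FiniteIndex :=
      ((W j).toFiniteIndexNormalSubgroup.comap κ).isFiniteIndex'
    exact firstBetti_eq_of_isProfiniteDense (hι.subgroupComap (W j)) (hκ.subgroupComap (W j))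
  have hlim := hG.tendsto_comap hι hW hWU
  simp only [hb] at hlim
  exact tendsto_nhds_unique hlim (hH.tendsto_comap hκ hW hWV)

end L2Betti

theorem theorem5 (Γ : Type*) (Δ : Type*) [Group Γ] [Group Δ]
    (hΓ : L2Betti.IsLucky Γ) (hΔ : L2Betti.IsLucky Δ)
    (h : Nonempty (L2Betti.Completion Γ ≃ₜ* L2Betti.Completion Δ)) :
    L2Betti.firstL2Betti Γ = L2Betti.firstL2Betti Δ := by
  obtain ⟨e⟩ := h
  exact hΓ.firstL2Betti_eq hΔ
    ((L2Betti.IsProfiniteDense.completion Γ).comp_continuousMulEquiv e)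
    (L2Betti.IsProfiniteDense.completion Δ)
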